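/- Let $\mathbb K\in\{\mathbb R,\mathbb C\}$. A \emph{maximal sequence space} $X$ is a Banach space of scalar sequences with $\ell_1\subset X\subset\ell_\infty$ and $\|e_k\|_X=1$ for all unit vectors $e_k$, such that (i) $\|\alpha\sigma\|_X\le\|\alpha\|_\infty\|\sigma\|_X$ (and $\alpha\sigma\in X$) for $\alpha\in\ell_\infty$, $\sigma\in X$, and (ii) $\sigma\in X$ if and only if $(\|P_n\sigma\|_X)_n$ is bounded, where $P_n\sigma=\sum_{k\le n}\sigma_ke_k$, and then $\|\sigma\|_X=\sup_n\|P_n\sigma\|_X$. It is \emph{symmetric} if a bounded sequence $\sigma$ lies in $X$ exactly when its non-increasing rearrangement $\sigma^*$ does, with $\|\sigma^*\|_X=\|\sigma\|_X$. It is \emph{$q$-convex} if for some $c>0$ one has $\|(\sum_{k\le n}|x_k|^q)^{1/q}\|_X\le c\,(\sum_{k\le n}\|x_k\|_X^q)^{1/q}$ for all $n$ and all $x_1,\dots,x_n\in X$ (maxima if $q=\infty$); $M^q(X)$ is the best such $c$. For a bounded linear operator $T:E\to F$ between Banach spaces and $n\in\mathbb N$ let $$\pi^n_{X,r}(T)=\sup\Big\{\Big\|\sum_{k=1}^n\|Tx_k\|_F\,e_k\Big\|_X:\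 x_1,\dots,x_n\in E,\ \sup_{a\in B_{E^*}}\Big(\sum_{k=1}^n|\langle x_k,a\rangle|^r\Big)^{1/r}\le1\Big\},$$ $$rc^n_X(T)=\sup\Big\{\Big\|\sum_{k=1}^n\|Tx_k\|_F\,e_k\Big\|_X:\ x_1,\dots,x_n\in E,\ \Big\|\sum_{k=1}^n\varepsilon_kx_k\Big\|_{L_2(E)}\le1\Big\},$$ where $(\varepsilon_k)$ are independent random signs. $T$ is $(X,r)$-summing if $\sup_n\pi^n_{X,r}(T)<\infty$, and of Rademacher cotype $X$ if $\sup_n rc^n_X(T)<\infty$. \textbf{Theorem.} There is an absolute constant $c_0>0$ such that the following holds. Let $1<q\le\infty$, let $X$ be a $q$-convex maximal symmetric sequence space, let $K$ be a compact Hausdorff space, $F$ a Banach space and $T:C(K)\to F$ a bounded linear operator. With $\frac1q+\frac1{q'}=1$: (1) For all $1\le r<q$ and all $n\in\mathbb N$, $$\pi^n_{X,r}(T)\ \le\ c_0\,M^q(X)\,\frac1r\Big(\frac1r-\frac1q\Big)^{-1/q'}\pi^n_{X,1}(T).$$ (2) If $q>2$, then for all $n\in\mathbb N$ $$\pi^n_{X,1}(T)\le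 rc^n_X(T)\le\sqrt2\,\pi^n_{X,2}(T)\le c_0\,M^q(X)\Big(\frac12-\frac1q\Big)^{-1/q'}\pi^n_{X,1}(T),$$ and the following are equivalent: $T$ is $(X,2)$-summing; $T$ is of Rademacher cotype $X$; $T$ is $(X,1)$-summing. -/

import Mathlib

open Filter Topology
open scoped ENNReal

/-- The truncation `P_n σ = (σ_0, …, σ_{n-1}, 0, 0, …)` of a sequence. -/
def seqTrunc {𝕜 : Type*} [RCLike 𝕜] (n : ℕ) (σ : ℕ → 𝕜) : ℕ → 𝕜 :=
  fun k => if k < n then σ k else 0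

/-- The sequence `∑_{k < n} σ_k e_k` attached to a vector `σ ∈ 𝕜ⁿ`. -/
def finSeq {𝕜 : Type*} [RCLike 𝕜] {n : ℕ} (σ : Fin n → 𝕜) : ℕ → 𝕜 :=
  fun k => if h : k < n then σ ⟨k, h⟩ else 0

/-- The non-increasing rearrangement of a bounded sequence (indices start at `0`):
`σ*_n = inf {t ≥ 0 : at most n indices k satisfy |σ_k| > t}`. -/
noncomputable def decRearr {𝕜 : Type*} [RCLike 𝕜] (σ : ℕ → 𝕜) (n : ℕ) : ℝ :=
  sInf {t : ℝ | 0 ≤ t ∧ {k : ℕ | t < ‖σ k‖}.encard ≤ (n : ℕ∞)}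

/-- The `ℓ_p^n`-norm, `1 ≤ p ≤ ∞` (the maximum of the moduli for `p = ∞`). -/
noncomputable def finLpNorm {𝕜 : Type*} [RCLike 𝕜] (p : ℝ≥0∞) {n : ℕ} (v : Fin n → 𝕜) : ℝ :=
  ‖(WithLp.toLp p v : PiLp p (fun _ : Fin n => 𝕜))‖

/-- A maximal sequence space over `𝕜`: a Banach space of scalar sequences with
`ℓ_1 ⊆ X ⊆ ℓ_∞`, normalized unit vectors, the ideal property with respect to multiplication by
bounded sequences, and the maximality (Fatou) property.
The values of `norm` at sequences outside `carrier` carry no information. -/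
structure MaximalSequenceSpace (𝕜 : Type*) [RCLike 𝕜] where
  carrier : Submodule 𝕜 (ℕ → 𝕜)
  norm : (ℕ → 𝕜) → ℝ
  norm_add_le : ∀ σ ∈ carrier, ∀ τ ∈ carrier, norm (σ + τ) ≤ norm σ + norm τ
  norm_smul : ∀ (c : 𝕜), ∀ σ ∈ carrier, norm (c • σ) = ‖c‖ * norm σ
  eq_zero_of_norm_eq_zero : ∀ σ ∈ carrier, norm σ = 0 → σ = 0
  complete : ∀ u : ℕ → ℕ → 𝕜, (∀ m, u m ∈ carrier) →
    (∀ ε > 0, ∃ N, ∀ m ≥ N, ∀ l ≥ N, norm (u m - u l) < ε) →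
    ∃ σ ∈ carrier, Tendsto (fun m => norm (u m - σ)) atTop (𝓝 0)
  mem_of_memℓp_one : ∀ σ : ℕ → 𝕜, Memℓp σ 1 → σ ∈ carrier
  memℓp_top_of_mem : ∀ σ ∈ carrier, Memℓp σ ∞
  norm_single : ∀ k : ℕ, norm (Pi.single k 1) = 1
  mul_mem : ∀ (α : lp (fun _ : ℕ => 𝕜) ∞), ∀ σ ∈ carrier, (fun k => α k * σ k) ∈ carrier
  norm_mul_le : ∀ (α : lp (fun _ : ℕ => 𝕜) ∞), ∀ σ ∈ carrier,
    norm (fun k => α k * σ k) ≤ norm σ * ‖α‖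
  mem_iff_bddAbove : ∀ σ : ℕ → 𝕜,
    σ ∈ carrier ↔ BddAbove (Set.range fun n => norm (seqTrunc n σ))
  norm_isLUB : ∀ σ ∈ carrier, IsLUB (Set.range fun n => norm (seqTrunc n σ)) (norm σ)

namespace MaximalSequenceSpace

/-- `X` is symmetric: a bounded sequence `σ` lies in `X` iff `σ*` does, and then the norms of
`σ` and `σ*` agree. -/
def IsSymmetric {𝕜 : Type*} [RCLike 𝕜] (X : MaximalSequenceSpace 𝕜) : Prop :=
  ∀ σ : ℕ → 𝕜, Memℓp σ ∞ →
    (σ ∈ X.carrier ↔ (fun n => (decRearr σ n : 𝕜)) ∈ X.carrier) ∧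
    (σ ∈ X.carrier → X.norm (fun n => (decRearr σ n : 𝕜)) = X.norm σ)

/-- `‖(∑_k |x_k|^p)^{1/p}‖_X ≤ c (∑_k ‖x_k‖_X^p)^{1/p}` for all finite families in `X`
(with maxima in place of the `p`-sums for `p = ∞`). -/
def ConvexWith {𝕜 : Type*} [RCLike 𝕜] (X : MaximalSequenceSpace 𝕜) (p : ℝ≥0∞) (c : ℝ) : Prop :=
  ∀ (n : ℕ) (x : Fin n → ℕ → 𝕜), (∀ k, x k ∈ X.carrier) →
    X.norm (fun i => (finLpNorm p (fun k => x k i) : 𝕜)) ≤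
      c * finLpNorm p (fun k => X.norm (x k))

/-- `X` is `p`-convex. -/
def IsConvex {𝕜 : Type*} [RCLike 𝕜] (X : MaximalSequenceSpace 𝕜) (p : ℝ≥0∞) : Prop :=
  ∃ c : ℝ, 0 < c ∧ X.ConvexWith p c

/-- The `p`-convexity constant `M^p(X)`. -/
noncomputable def convexityConst {𝕜 : Type*} [RCLike 𝕜] (X : MaximalSequenceSpace 𝕜)
    (p : ℝ≥0∞) : ℝ :=
  sInf {c : ℝ | 0 < c ∧ X.ConvexWith p c}

end MaximalSequenceSpace

/-- `ω_r(x_k)_1^n = sup_{a ∈ B_{E*}} (∑_k |⟨x_k, a⟩|^r)^{1/r}`. -/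
noncomputable def weakLpNorm (𝕜 : Type*) [RCLike 𝕜] {E : Type*} [NormedAddCommGroup E]
    [NormedSpace 𝕜 E] (r : ℝ≥0∞) {n : ℕ} (x : Fin n → E) : ℝ≥0∞ :=
  ⨆ (a : StrongDual 𝕜 E) (_ : ‖a‖ ≤ 1), ENNReal.ofReal (finLpNorm r (fun k => a (x k)))

/-- `‖∑_k ε_k x_k‖_{L_2(E)}` for independent random signs `ε_k`: the quadratic mean of
`‖∑_k ε_k x_k‖` over all `2ⁿ` choices of signs. -/
noncomputable def rademacherNorm {E : Type*} [NormedAddCommGroup E] {n : ℕ} (x : Fin n → E) : ℝ :=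
  Real.sqrt (((2 : ℝ) ^ n)⁻¹ * ∑ ε : Fin n → ℤˣ, ‖∑ k, ((ε k : ℤˣ) : ℤ) • x k‖ ^ 2)

/-- `‖∑_{k ≤ n} ‖T x_k‖ e_k‖_X`. -/
noncomputable def imageNorm {𝕜 : Type*} [RCLike 𝕜] {E F : Type*} [NormedAddCommGroup E]
    [NormedSpace 𝕜 E] [NormedAddCommGroup F] [NormedSpace 𝕜 F] (X : MaximalSequenceSpace 𝕜)
    (T : E →L[𝕜] F) {n : ℕ} (x : Fin n → E) : ℝ :=
  X.norm (finSeq fun k => (‖T (x k)‖ : 𝕜))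

/-- The `(X,r)`-summing norm `π^n_{X,r}(T)` on `n` vectors. -/
noncomputable def summingNorm {𝕜 : Type*} [RCLike 𝕜] {E F : Type*} [NormedAddCommGroup E]
    [NormedSpace 𝕜 E] [NormedAddCommGroup F] [NormedSpace 𝕜 F] (X : MaximalSequenceSpace 𝕜)
    (r : ℝ≥0∞) (n : ℕ) (T : E →L[𝕜] F) : ℝ≥0∞ :=
  ⨆ (x : Fin n → E) (_ : weakLpNorm 𝕜 r x ≤ 1), ENNReal.ofReal (imageNorm X T x)

/-- The Rademacher cotype `X` constant `rc^n_X(T)` on `n` vectors. -/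
noncomputable def rademacherCotypeNorm {𝕜 : Type*} [RCLike 𝕜] {E F : Type*} [NormedAddCommGroup E]
    [NormedSpace 𝕜 E] [NormedAddCommGroup F] [NormedSpace 𝕜 F] (X : MaximalSequenceSpace 𝕜)
    (n : ℕ) (T : E →L[𝕜] F) : ℝ≥0∞ :=
  ⨆ (x : Fin n → E) (_ : rademacherNorm x ≤ 1), ENNReal.ofReal (imageNorm X T x)

/-- `T` is (absolutely) `(X,r)`-summing: `π_{X,r}(T) = sup_n π^n_{X,r}(T) < ∞`. -/
def IsSumming {𝕜 : Type*} [RCLike 𝕜] {E F : Type*} [NormedAddCommGroup E]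
    [NormedSpace 𝕜 E] [NormedAddCommGroup F] [NormedSpace 𝕜 F] (X : MaximalSequenceSpace 𝕜)
    (r : ℝ≥0∞) (T : E →L[𝕜] F) : Prop :=
  (⨆ n : ℕ, summingNorm X r n T) < ∞

/-- `T` is of Rademacher cotype `X`: `rc_X(T) = sup_n rc^n_X(T) < ∞`. -/
def IsOfRademacherCotype {𝕜 : Type*} [RCLike 𝕜] {E F : Type*} [NormedAddCommGroup E]
    [NormedSpace 𝕜 E] [NormedAddCommGroup F] [NormedSpace 𝕜 F] (X : MaximalSequenceSpace 𝕜)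
    (T : E →L[𝕜] F) : Prop :=
  (⨆ n : ℕ, rademacherCotypeNorm X n T) < ∞

/-- The factor `(1/r) (1/r - 1/q)^{-1/q'}`, where `1/q' = 1 - 1/q` and `1/∞ = 0`. -/
noncomputable def maureyFactor (r q : ℝ≥0∞) : ℝ :=
  (r⁻¹).toReal * ((r⁻¹).toReal - (q⁻¹).toReal) ^ (-(1 - (q⁻¹).toReal))

/-!
The substance is the passage from weakly `r`-summable to weakly `1`-summable families in `C(K)`,
with the loss `(1/r) (1/r - 1/q)^{-1/q'}`. It is achieved by a random choice of slices.

Let `∑ k, |x k|^r ≤ 1` on `K`. Cutting the moduli at the heights `2^{-l/r}` writes every `x k` as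
`∑ l, p l * s l * g k l` with normalized slices `|g k l| ≤ 1`, where `p l` is about `2^{-l}`. Since
`g k l` is nonzero only where `|x k|^r > 2^{-(l+1)}`, the mean overlap `∑ k, ∑ l, p l * |g k l|` is
at most `3`, while the coefficients `s` have `L_{q'}(p)`-norm at most
`4 (1/r) (1/r - 1/q)^{-1/q'}` (`exists_slicing`).

Now let each `k` choose independently a level `ω k` with law `p`, and put
`S ω = ∑ i, |g i (ω i)|`. The functions `g k (ω k) / (1 + S ω)` have overlap at most `1`. The
conditional mean of the damping factor `1 / (1 + S ω)`, given `ω k = l`, is a continuous function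
bounded below by `1/5`, by Jensen's inequality; dividing by it, and by `5`, gives a family `y ω` of
overlap at most `1` for which `x k = 5 𝔼[s (ω k) • y ω k]` holds exactly
(`exists_disjointification`). Hölder's inequality gives
`‖T (x k)‖ ≤ 5 ‖s‖_{L_{q'}(p)} (𝔼 ‖T (y ω k)‖^q)^{1/q}`, and `q`-convexity of `X` bounds the norm of
the right-hand side by that of the worst single family `y ω`, which is weakly `1`-summable with
constant `1` and has as many members as `x` (`exists_imageNorm_le`).

The two inequalities involving Rademacher averages hold in every Banach space: signed sums of a
weakly `1`-summable family are bounded, and by orthogonality of the signs the weak `ℓ_2`-norm is at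
most the Rademacher norm.
-/

/-! ### Independent choices from a finite set -/

section ProductWeights

variable {ι L : Type*} [Fintype ι] [DecidableEq ι]

theorem sum_prod_weights_eq_one [Fintype L] {p : L → ℝ} (hp1 : ∑ l, p l = 1) :
    ∑ ω : ι → L, ∏ i, p (ω i) = 1 := by
  classical
  have h := Finset.prod_univ_sum (fun _ : ι => (Finset.univ : Finset L)) (fun _ l => p l)
  simp only [hp1, Finset.prod_const_one, Fintype.piFinset_univ] at h
  exact h.symm

theorem prod_update_mul (p : L → ℝ) (k : ι) (l : L) (ω : ι → L) :
    (∏ i, p (Function.update ω k l i)) * p (ω k) = (∏ i, p (ω i)) * p l := by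
  rw [← Finset.mul_prod_erase _ _ (Finset.mem_univ k),
    ← Finset.mul_prod_erase _ (fun i => p (ω i)) (Finset.mem_univ k)]
  have h : ∏ i ∈ Finset.univ.erase k, p (Function.update ω k l i) =
      ∏ i ∈ Finset.univ.erase k, p (ω i) :=
    Finset.prod_congr rfl fun i hi => by
      rw [Function.update_of_ne (Finset.ne_of_mem_erase hi)]
  rw [h, Function.update_self]
  ring

/-- Resampling the coordinate `k` of a random vector with independent coordinates of law `p`
does not change its law. -/
theorem sum_prod_weights_smul_update [Fintype L] {M : Type*} [AddCommGroup M] [Module ℝ M]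
    {p : L → ℝ} (hp1 : ∑ l, p l = 1) (k : ι) (f : (ι → L) → M) :
    ∑ ω : ι → L, (∏ i, p (ω i)) • f ω =
      ∑ l, p l • ∑ ω : ι → L, (∏ i, p (ω i)) • f (Function.update ω k l) := by
  have h1 : ∑ l, p l • ∑ ω : ι → L, (∏ i, p (ω i)) • f (Function.update ω k l) =
      ∑ z : (ι → L) × L, ((∏ i, p (z.1 i)) * p z.2) • f (Function.update z.1 k z.2) := by
    rw [Fintype.sum_prod_type, Finset.sum_comm' (t' := Finset.univ) (s' := fun _ => Finset.univ)
      (by simp)]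
    simp only [Finset.smul_sum, smul_smul, mul_comm]
  -- `(ω, l) ↦ (ω with l in place of ω k, ω k)` is an involution preserving the weights.
  let e : (ι → L) × L → (ι → L) × L := fun z => (Function.update z.1 k z.2, z.1 k)
  have he : Function.Involutive e := fun z => by simp [e]
  have h2 : ∑ z : (ι → L) × L, ((∏ i, p (z.1 i)) * p z.2) • f (Function.update z.1 k z.2) =
      ∑ z : (ι → L) × L, ((∏ i, p (z.1 i)) * p z.2) • f z.1 := by
    refine Fintype.sum_equiv he.toPerm _ _ fun z => ?_
    simp only [Function.Involutive.coe_toPerm, e]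
    rw [prod_update_mul]
  rw [h1, h2, Fintype.sum_prod_type]
  refine Finset.sum_congr rfl fun ω _ => ?_
  simp only [← Finset.sum_smul, ← Finset.mul_sum, hp1, mul_one]

theorem sum_prod_weights_mul_marginal [Fintype L] {p : L → ℝ} (hp1 : ∑ l, p l = 1) (k : ι)
    (φ : L → ℝ) :
    ∑ ω : ι → L, (∏ i, p (ω i)) * φ (ω k) = ∑ l, p l * φ l := by
  have h := sum_prod_weights_smul_update hp1 k (fun ω : ι → L => φ (ω k))
  simp only [smul_eq_mul, Function.update_self, ← Finset.sum_mul,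
    sum_prod_weights_eq_one hp1, one_mul] at h
  exact h

end ProductWeights

/-! ### Random disjointification of families of continuous functions -/

section Disjointification

variable {𝕜 : Type*} [RCLike 𝕜] {K : Type*} [TopologicalSpace K]
  {ι L : Type*} [Fintype ι]

theorem one_add_sum_norm_pos (g : ι → L → C(K, 𝕜)) (ω : ι → L) (t : K) :
    0 < 1 + ∑ i, ‖g i (ω i) t‖ := by
  have : 0 ≤ ∑ i, ‖g i (ω i) t‖ := Finset.sum_nonneg fun i _ => norm_nonneg _
  linarith

variable [DecidableEq ι] [Fintype L]

/-- The conditional expectation, given that `k` selects `l`, of the damping factor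
`1 / (1 + ∑ i, |g i (ω i) t|)`. By independence, the conditioning amounts to overwriting `ω k`
by `l`. -/
noncomputable def meanDamping (p : L → ℝ) (g : ι → L → C(K, 𝕜)) (k : ι) (l : L) (t : K) : ℝ :=
  ∑ ω : ι → L, (∏ i, p (ω i)) * (1 + ∑ i, ‖g i (Function.update ω k l i) t‖)⁻¹

theorem continuous_meanDamping (p : L → ℝ) (g : ι → L → C(K, 𝕜)) (k : ι) (l : L) :
    Continuous (meanDamping p g k l) := by
  unfold meanDamping
  refine continuous_finsetSum _ fun ω _ => continuous_const.mul (Continuous.inv₀ ?_ fun t => ?_)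
  · fun_prop
  · exact (one_add_sum_norm_pos g _ t).ne'

/-- Since the mean of `∑ i, |g i (ω i)|` is at most `A`, Jensen's inequality for `1 / x` bounds
the mean damping factor from below. -/
theorem inv_le_meanDamping {p : L → ℝ} (hp : ∀ l, 0 ≤ p l) (hp1 : ∑ l, p l = 1)
    {g : ι → L → C(K, 𝕜)} (hg : ∀ k l t, ‖g k l t‖ ≤ 1) {A : ℝ} (hA : 0 ≤ A) {t : K}
    (hgA : ∑ k, ∑ l, p l * ‖g k l t‖ ≤ A) (k : ι) (l : L) :
    (2 + A)⁻¹ ≤ meanDamping p g k l t := by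
  set m := 2 + A with hm
  have hm0 : 0 < m := by positivity
  have hmean : ∑ ω : ι → L, (∏ i, p (ω i)) * (2 + ∑ i, ‖g i (ω i) t‖) ≤ m := by
    simp only [mul_add, Finset.sum_add_distrib, ← Finset.sum_mul, sum_prod_weights_eq_one hp1,
      Finset.mul_sum]
    rw [Finset.sum_comm]
    have : ∀ i : ι, ∑ ω : ι → L, (∏ i, p (ω i)) * ‖g i (ω i) t‖ = ∑ l, p l * ‖g i l t‖ :=
      fun i => sum_prod_weights_mul_marginal hp1 i fun l => ‖g i l t‖
    simp only [this]
    linarith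
  have hupd : ∀ ω : ι → L,
      1 + ∑ i, ‖g i (Function.update ω k l i) t‖ ≤ 2 + ∑ i, ‖g i (ω i) t‖ := by
    intro ω
    rw [← Finset.add_sum_erase _ _ (Finset.mem_univ k),
      ← Finset.add_sum_erase _ (fun i => ‖g i (ω i) t‖) (Finset.mem_univ k)]
    have h : ∑ i ∈ Finset.univ.erase k, ‖g i (Function.update ω k l i) t‖ =
        ∑ i ∈ Finset.univ.erase k, ‖g i (ω i) t‖ :=
      Finset.sum_congr rfl fun i hi => by
        rw [Function.update_of_ne (Finset.ne_of_mem_erase hi)]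
    rw [h, Function.update_self]
    linarith [hg k l t, norm_nonneg (g k (ω k) t)]
  -- The tangent line of `1 / x` at `x = m` lies below the graph.
  have htan : ∀ x : ℝ, 0 < x → 2 / m - x / m ^ 2 ≤ x⁻¹ := by
    intro x hx
    have : x⁻¹ - (2 / m - x / m ^ 2) = (x - m) ^ 2 / (x * m ^ 2) := by
      field_simp
      ring
    have h2 : 0 ≤ (x - m) ^ 2 / (x * m ^ 2) := by positivity
    linarith
  calc m⁻¹ = 2 / m - m / m ^ 2 := by field_simp; ring
    _ ≤ 2 / m - (∑ ω : ι → L, (∏ i, p (ω i)) * (2 + ∑ i, ‖g i (ω i) t‖)) / m ^ 2 := by gcongr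
    _ = ∑ ω : ι → L, (∏ i, p (ω i)) * (2 / m - (2 + ∑ i, ‖g i (ω i) t‖) / m ^ 2) := by
        simp only [mul_sub, Finset.sum_sub_distrib, Finset.sum_div, mul_div_assoc]
        rw [← Finset.sum_mul, sum_prod_weights_eq_one hp1, one_mul]
    _ ≤ meanDamping p g k l t := by
        refine Finset.sum_le_sum fun ω _ => ?_
        refine mul_le_mul_of_nonneg_left ?_ (Finset.prod_nonneg fun i _ => hp _)
        refine le_trans ?_ (htan _ (one_add_sum_norm_pos g _ t))
        have := div_le_div_of_nonneg_right (hupd ω) (sq_nonneg m)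
        linarith

/-- A family `g k l` of functions bounded by `1` whose expected overlap under the law `p` is at
most `A` is an average of families of overlap at most `1`: for every choice `ω` of one `l` for
each `k` there is a family `y ω k` with `∑ k, |y ω k| ≤ 1`, such that, up to the factor `2 + A`,
averages of the `g k l` over `l` are averages of the `y ω k` over `ω`. -/
theorem exists_disjointification {p : L → ℝ} (hp : ∀ l, 0 ≤ p l) (hp1 : ∑ l, p l = 1)
    {g : ι → L → C(K, 𝕜)} (hg : ∀ k l t, ‖g k l t‖ ≤ 1) {A : ℝ} (hA : 0 ≤ A)
    (hgA : ∀ t, ∑ k, ∑ l, p l * ‖g k l t‖ ≤ A) :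
    ∃ y : (ι → L) → ι → C(K, 𝕜), (∀ ω t, ∑ k, ‖y ω k t‖ ≤ 1) ∧
      ∀ (s : L → ℝ) (k : ι), ∑ l, ((p l * s l : ℝ) : 𝕜) • g k l =
        ((2 + A : ℝ) : 𝕜) • ∑ ω : ι → L, (((∏ i, p (ω i)) * s (ω k) : ℝ) : 𝕜) • y ω k := by
  set m := 2 + A with hm
  have hm0 : 0 < m := by positivity
  have hH : ∀ k l t, m⁻¹ ≤ meanDamping p g k l t := fun k l t =>
    inv_le_meanDamping hp hp1 hg hA (hgA t) k l
  have hH0 : ∀ k l t, 0 < meanDamping p g k l t := fun k l t => (inv_pos.2 hm0).trans_le (hH k l t)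
  -- Dividing by `meanDamping` makes the conditional mean of the damping factor constant.
  let d : (ι → L) → ι → K → ℝ := fun ω k t =>
    (m * meanDamping p g k (ω k) t)⁻¹ * (1 + ∑ i, ‖g i (ω i) t‖)⁻¹
  have hd : ∀ ω k, Continuous (d ω k) := fun ω k => by
    refine Continuous.mul (Continuous.inv₀ ?_ fun t => ?_) (Continuous.inv₀ ?_ fun t => ?_)
    · exact continuous_const.mul (continuous_meanDamping p g k _)
    · exact (mul_pos hm0 (hH0 _ _ _)).ne'
    · fun_prop
    · exact (one_add_sum_norm_pos g _ t).ne'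
  refine ⟨fun ω k => ⟨fun t => ((d ω k t : ℝ) : 𝕜) * g k (ω k) t,
    (RCLike.continuous_ofReal.comp (hd ω k)).mul (g k (ω k)).continuous⟩, ?_, ?_⟩
  · intro ω t
    have hS := one_add_sum_norm_pos g ω t
    have : ∀ k, ‖((d ω k t : ℝ) : 𝕜) * g k (ω k) t‖ ≤
        (1 + ∑ i, ‖g i (ω i) t‖)⁻¹ * ‖g k (ω k) t‖ := by
      intro k
      have h1 : (m * meanDamping p g k (ω k) t)⁻¹ ≤ 1 := by
        apply inv_le_one_of_one_le₀
        have := mul_le_mul_of_nonneg_left (hH k (ω k) t) hm0.le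
        rwa [mul_inv_cancel₀ hm0.ne'] at this
      have h0 : 0 ≤ (m * meanDamping p g k (ω k) t)⁻¹ :=
        inv_nonneg.2 (mul_pos hm0 (hH0 _ _ _)).le
      have h2 : 0 ≤ (1 + ∑ i, ‖g i (ω i) t‖)⁻¹ := inv_nonneg.2 hS.le
      rw [norm_mul, RCLike.norm_ofReal, abs_of_nonneg (mul_nonneg h0 h2)]
      gcongr
      exact mul_le_of_le_one_left h2 h1
    calc ∑ k, ‖((d ω k t : ℝ) : 𝕜) * g k (ω k) t‖
        ≤ ∑ k, (1 + ∑ i, ‖g i (ω i) t‖)⁻¹ * ‖g k (ω k) t‖ := Finset.sum_le_sum fun k _ => this k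
      _ = (1 + ∑ i, ‖g i (ω i) t‖)⁻¹ * ∑ k, ‖g k (ω k) t‖ := by rw [Finset.mul_sum]
      _ ≤ 1 := by
          rw [inv_mul_le_iff₀ hS]
          linarith
  · intro s k
    ext t
    simp only [ContinuousMap.coe_sum, ContinuousMap.coe_smul, Finset.sum_apply, Pi.smul_apply,
      ContinuousMap.coe_mk, smul_eq_mul]
    have key := sum_prod_weights_smul_update hp1 k
      (fun ω : ι → L => (s (ω k) * d ω k t) • g k (ω k) t)
    have inner : ∀ l, ∑ ω : ι → L, (∏ i, p (ω i)) •
        ((s (Function.update ω k l k) * d (Function.update ω k l) k t) •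
          g k (Function.update ω k l k) t) = (m⁻¹ * s l) • g k l t := by
      intro l
      simp only [Function.update_self, d, smul_smul, ← Finset.sum_smul]
      congr 1
      have h0 := (hH0 k l t).ne'
      have e : ∀ ω : ι → L, (∏ i, p (ω i)) * (s l * ((m * meanDamping p g k l t)⁻¹ *
          (1 + ∑ i, ‖g i (Function.update ω k l i) t‖)⁻¹)) =
          (s l * (m * meanDamping p g k l t)⁻¹) *
            ((∏ i, p (ω i)) * (1 + ∑ i, ‖g i (Function.update ω k l i) t‖)⁻¹) :=
        fun ω => by ring
      rw [Finset.sum_congr rfl fun ω _ => e ω, ← Finset.mul_sum]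
      change s l * (m * meanDamping p g k l t)⁻¹ * meanDamping p g k l t = _
      field_simp
    simp only [inner] at key
    have lhs : ∀ ω : ι → L, (((∏ i, p (ω i)) * s (ω k) : ℝ) : 𝕜) *
        (((d ω k t : ℝ) : 𝕜) * g k (ω k) t) =
        (∏ i, p (ω i)) • ((s (ω k) * d ω k t) • g k (ω k) t) := by
      intro ω
      simp only [RCLike.real_smul_eq_coe_mul]
      push_cast
      ring
    rw [Finset.sum_congr rfl fun ω _ => lhs ω, key, Finset.mul_sum]
    refine Finset.sum_congr rfl fun l _ => ?_
    have hm' : ((m : ℝ) : 𝕜) ≠ 0 := RCLike.ofReal_ne_zero.2 hm0.ne'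
    simp only [RCLike.real_smul_eq_coe_mul]
    push_cast
    field_simp

end Disjointification

/-! ### Finite `ℓ_p`-norms -/

section FinLpNorm

variable {𝕜 : Type*} [RCLike 𝕜] {n : ℕ}

theorem finLpNorm_nonneg (q : ℝ≥0∞) (v : Fin n → 𝕜) : 0 ≤ finLpNorm q v := by
  unfold finLpNorm
  rcases q.trichotomy with rfl | rfl | h
  · rw [PiLp.norm_eq_card]; positivity
  · rw [PiLp.norm_eq_ciSup]; exact Real.iSup_nonneg fun i => norm_nonneg _
  · rw [PiLp.norm_eq_sum h]; positivity

theorem finLpNorm_eq_sum {q : ℝ≥0∞} (hq : 0 < q.toReal) (v : Fin n → 𝕜) :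
    finLpNorm q v = (∑ k, ‖v k‖ ^ q.toReal) ^ (1 / q.toReal) :=
  PiLp.norm_eq_sum hq _

theorem finLpNorm_top (v : Fin n → 𝕜) : finLpNorm ∞ v = ⨆ k, ‖v k‖ :=
  PiLp.norm_eq_ciSup _

theorem finLpNorm_one (v : Fin n → 𝕜) : finLpNorm 1 v = ∑ k, ‖v k‖ := by
  rw [finLpNorm_eq_sum (by simp)]
  simp

theorem finLpNorm_zero {q : ℝ≥0∞} (hq : 1 ≤ q) : finLpNorm q (fun _ : Fin n => (0 : 𝕜)) = 0 := by
  have : Fact (1 ≤ q) := ⟨hq⟩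
  exact norm_zero (E := PiLp q fun _ : Fin n => 𝕜)

theorem finLpNorm_congr_norm {𝕜' : Type*} [RCLike 𝕜'] {q : ℝ≥0∞} (hq : 1 ≤ q) {v : Fin n → 𝕜}
    {w : Fin n → 𝕜'} (h : ∀ k, ‖v k‖ = ‖w k‖) : finLpNorm q v = finLpNorm q w := by
  rcases eq_or_ne q ∞ with rfl | hq'
  · simp only [finLpNorm_top, h]
  · have := ENNReal.toReal_pos (zero_lt_one.trans_le hq).ne' hq'
    simp only [finLpNorm_eq_sum this, h]

/-- Hölder's inequality with respect to a probability weight `P`. The number `1 / q` is written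
as `(q⁻¹).toReal`, which is `0` for `q = ∞`; the conjugate exponent is `1 / (1 - 1 / q)`. -/
theorem sum_weight_mul_le_finLpNorm {q : ℝ≥0∞} (hq : 1 < q) {P u z : Fin n → ℝ}
    (hP : ∀ j, 0 ≤ P j) (hu : ∀ j, 0 ≤ u j) :
    ∑ j, P j * u j * z j ≤
      (∑ j, P j * u j ^ (1 - (q⁻¹).toReal)⁻¹) ^ (1 - (q⁻¹).toReal) *
        finLpNorm q (fun j => P j ^ (q⁻¹).toReal * z j) := by
  rcases eq_or_ne q ∞ with rfl | hq'
  · simp only [ENNReal.inv_top, ENNReal.toReal_zero, sub_zero, inv_one, Real.rpow_one,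
      Real.rpow_zero, one_mul, Finset.sum_mul, finLpNorm_top]
    refine Finset.sum_le_sum fun j _ => mul_le_mul_of_nonneg_left ?_ (mul_nonneg (hP j) (hu j))
    exact (le_abs_self _).trans (le_ciSup (f := fun j => ‖z j‖) (Finite.bddAbove_range _) j)
  · have hqr : 1 < q.toReal := by
      rw [← ENNReal.toReal_one]
      exact ENNReal.toReal_strict_mono hq' hq
    have hq0 : 0 < q.toReal := by linarith
    rw [finLpNorm_eq_sum hq0, ENNReal.toReal_inv]
    set β := q.toReal with hβ
    have hc : (1 - β⁻¹)⁻¹.HolderConjugate β := by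
      have h := (Real.HolderConjugate.conjExponent hqr).symm
      have e : (1 - β⁻¹)⁻¹ = β.conjExponent := by
        unfold Real.conjExponent
        field_simp
      rwa [e]
    have hγ : 0 < 1 - β⁻¹ := by
      have := inv_lt_one_of_one_lt₀ hqr
      linarith
    have H := Real.inner_le_Lp_mul_Lq Finset.univ (fun j => P j ^ (1 - β⁻¹) * u j)
      (fun j => P j ^ β⁻¹ * z j) hc
    have e1 : ∀ j, |P j ^ (1 - β⁻¹) * u j| ^ (1 - β⁻¹)⁻¹ = P j * u j ^ (1 - β⁻¹)⁻¹ := by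
      intro j
      rw [abs_of_nonneg (mul_nonneg (Real.rpow_nonneg (hP j) _) (hu j)),
        Real.mul_rpow (Real.rpow_nonneg (hP j) _) (hu j), ← Real.rpow_mul (hP j),
        mul_inv_cancel₀ hγ.ne', Real.rpow_one]
    have e2 : ∀ j, P j ^ (1 - β⁻¹) * u j * (P j ^ β⁻¹ * z j) = P j * u j * z j := by
      intro j
      have : P j ^ (1 - β⁻¹) * P j ^ β⁻¹ = P j := by
        rw [← Real.rpow_add' (hP j) (by simp)]
        simp
      linear_combination (u j * z j) * this
    simp only [e1, e2, one_div, inv_inv] at H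
    simpa only [Real.norm_eq_abs, one_div] using H

theorem finLpNorm_weight_mul_le {q : ℝ≥0∞} (hq : 1 < q) {P b : Fin n → ℝ} {B : ℝ}
    (hP : ∀ j, 0 ≤ P j) (hP1 : ∑ j, P j = 1) (hb : ∀ j, 0 ≤ b j) (hB : 0 ≤ B)
    (hbB : ∀ j, b j ≤ B) : finLpNorm q (fun j => P j ^ (q⁻¹).toReal * b j) ≤ B := by
  rcases eq_or_ne q ∞ with rfl | hq'
  · simp only [ENNReal.inv_top, ENNReal.toReal_zero, Real.rpow_zero, one_mul, finLpNorm_top]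
    exact Real.iSup_le (fun j => by rw [Real.norm_of_nonneg (hb j)]; exact hbB j) hB
  · have hq0 : 0 < q.toReal := ENNReal.toReal_pos (zero_lt_one.trans hq).ne' hq'
    rw [finLpNorm_eq_sum hq0, ENNReal.toReal_inv, one_div]
    have h : ∑ j, ‖P j ^ q.toReal⁻¹ * b j‖ ^ q.toReal ≤ B ^ q.toReal := by
      calc ∑ j, ‖P j ^ q.toReal⁻¹ * b j‖ ^ q.toReal ≤ ∑ j, P j * B ^ q.toReal := by
            refine Finset.sum_le_sum fun j _ => ?_
            rw [Real.norm_of_nonneg (mul_nonneg (Real.rpow_nonneg (hP j) _) (hb j)),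
              Real.mul_rpow (Real.rpow_nonneg (hP j) _) (hb j),
              Real.rpow_inv_rpow (hP j) hq0.ne']
            exact mul_le_mul_of_nonneg_left (Real.rpow_le_rpow (hb j) (hbB j) hq0.le) (hP j)
        _ = B ^ q.toReal := by rw [← Finset.sum_mul, hP1, one_mul]
    calc (∑ j, ‖P j ^ q.toReal⁻¹ * b j‖ ^ q.toReal) ^ q.toReal⁻¹
        ≤ (B ^ q.toReal) ^ q.toReal⁻¹ := by gcongr
      _ = B := Real.rpow_rpow_inv hB hq0.ne'

end FinLpNorm

/-! ### Maximal sequence spaces -/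

namespace MaximalSequenceSpace

variable {𝕜 : Type*} [RCLike 𝕜] (X : MaximalSequenceSpace 𝕜)

theorem norm_zero : X.norm 0 = 0 := by
  have := X.norm_smul 0 0 X.carrier.zero_mem
  simpa using this

theorem norm_nonneg {σ : ℕ → 𝕜} (hσ : σ ∈ X.carrier) : 0 ≤ X.norm σ := by
  have h1 := X.norm_smul (-1) σ hσ
  have h2 := X.norm_add_le σ hσ ((-1 : 𝕜) • σ) (X.carrier.smul_mem _ hσ)
  rw [h1] at h2
  simp only [neg_smul, one_smul, add_neg_cancel, X.norm_zero, norm_neg, norm_one, one_mul] at h2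
  linarith

theorem norm_mono {σ τ : ℕ → 𝕜} (hτ : τ ∈ X.carrier) (h : ∀ k, ‖σ k‖ ≤ ‖τ k‖) :
    X.norm σ ≤ X.norm τ := by
  have hb : ∀ k, ‖σ k / τ k‖ ≤ 1 := fun k => by
    rw [norm_div]
    exact div_le_one_of_le₀ (h k) (_root_.norm_nonneg _)
  have hmem : Memℓp (fun k => σ k / τ k) ∞ :=
    memℓp_infty ⟨1, by rintro _ ⟨k, rfl⟩; exact hb k⟩
  let α : lp (fun _ : ℕ => 𝕜) ∞ := ⟨fun k => σ k / τ k, hmem⟩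
  have hα : ‖α‖ ≤ 1 := lp.norm_le_of_forall_le zero_le_one hb
  have e : (fun k => α k * τ k) = σ := by
    funext k
    change σ k / τ k * τ k = σ k
    rcases eq_or_ne (τ k) 0 with h0 | h0
    · have := h k
      rw [h0, _root_.norm_zero, norm_le_zero_iff] at this
      simp [h0, this]
    · exact div_mul_cancel₀ _ h0
  have := X.norm_mul_le α τ hτ
  rw [e] at this
  exact this.trans (mul_le_of_le_one_right (X.norm_nonneg hτ) hα)

theorem mem_of_eventually_zero {σ : ℕ → 𝕜} (n : ℕ) (h : ∀ k, n ≤ k → σ k = 0) :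
    σ ∈ X.carrier := by
  refine X.mem_of_memℓp_one σ ?_
  refine (memℓp_zero ?_).of_exponent_ge zero_le_one
  refine (Set.finite_lt_nat n).subset fun k hk => ?_
  by_contra hkn
  exact hk (h k (not_lt.1 hkn))

theorem finSeq_mem {n : ℕ} (v : Fin n → 𝕜) : finSeq v ∈ X.carrier :=
  X.mem_of_eventually_zero n fun k hk => by simp [finSeq, not_lt.2 hk]

/-- The convexity inequality for finitely supported sequences and a probability weight `P`:
`‖(∑ j, P j |y j|^q)^{1/q}‖ ≤ c max_j ‖y j‖`, in a form in which `v` is only dominated by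
`C (∑ j, P j |y j|^q)^{1/q}`. -/
theorem ConvexWith.norm_finSeq_le {X : MaximalSequenceSpace 𝕜} {q : ℝ≥0∞} {c : ℝ} (hc : 0 < c)
    (hX : X.ConvexWith q c) (hq : 1 < q) {n N : ℕ} {P : Fin N → ℝ} (hP : ∀ j, 0 ≤ P j)
    (hP1 : ∑ j, P j = 1) {y : Fin N → Fin n → ℝ} {B C : ℝ}
    (hB : 0 ≤ B) (hyB : ∀ j, X.norm (finSeq fun k => (y j k : 𝕜)) ≤ B) (hC : 0 ≤ C)
    {v : Fin n → ℝ} (hv : ∀ k, |v k| ≤ C * finLpNorm q fun j => P j ^ (q⁻¹).toReal * y j k) :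
    X.norm (finSeq fun k => (v k : 𝕜)) ≤ C * (c * B) := by
  let Y : Fin N → ℕ → 𝕜 := fun j => ((P j ^ (q⁻¹).toReal : ℝ) : 𝕜) • finSeq fun k => (y j k : 𝕜)
  have hY : ∀ j, Y j ∈ X.carrier := fun j => X.carrier.smul_mem _ (X.finSeq_mem _)
  have hYn : ∀ j, X.norm (Y j) =
      P j ^ (q⁻¹).toReal * X.norm (finSeq fun k => (y j k : 𝕜)) := fun j => by
    rw [X.norm_smul _ _ (X.finSeq_mem _), RCLike.norm_ofReal,
      abs_of_nonneg (Real.rpow_nonneg (hP j) _)]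
  let τ : ℕ → 𝕜 := fun i => (finLpNorm q (fun j => Y j i) : 𝕜)
  have hτ : τ ∈ X.carrier := X.mem_of_eventually_zero n fun i hi => by
    have : (fun j => Y j i) = fun _ => (0 : 𝕜) := by
      funext j
      simp [Y, finSeq, not_lt.2 hi]
    simp only [τ, this, finLpNorm_zero hq.le, RCLike.ofReal_zero]
  have hmono : X.norm (finSeq fun k => (v k : 𝕜)) ≤ X.norm ((C : 𝕜) • τ) := by
    refine X.norm_mono (X.carrier.smul_mem _ hτ) fun i => ?_
    simp only [Pi.smul_apply, τ, RCLike.norm_ofReal, abs_of_nonneg hC,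
      abs_of_nonneg (finLpNorm_nonneg q _), smul_eq_mul, norm_mul]
    by_cases hi : i < n
    · simp only [finSeq, hi, dif_pos, RCLike.norm_ofReal]
      refine (hv ⟨i, hi⟩).trans_eq ?_
      congr 1
      refine finLpNorm_congr_norm hq.le fun j => ?_
      simp [Y, finSeq, hi, norm_mul]
    · simp only [finSeq, hi, dif_neg, not_false_eq_true, _root_.norm_zero]
      exact mul_nonneg hC (finLpNorm_nonneg _ _)
  refine hmono.trans ?_
  rw [X.norm_smul _ _ hτ, RCLike.norm_ofReal, abs_of_nonneg hC]
  refine mul_le_mul_of_nonneg_left ((hX N Y hY).trans ?_) hC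
  refine mul_le_mul_of_nonneg_left ?_ hc.le
  simp only [hYn]
  exact finLpNorm_weight_mul_le hq hP hP1 (fun j => X.norm_nonneg (X.finSeq_mem _)) hB hyB

theorem IsConvex.le_mul_convexityConst {X : MaximalSequenceSpace 𝕜} {q : ℝ≥0∞}
    (hX : X.IsConvex q) {a b : ℝ} (hb : 0 ≤ b)
    (h : ∀ c, 0 < c → X.ConvexWith q c → a ≤ c * b) : a ≤ X.convexityConst q * b := by
  rcases hb.eq_or_lt with rfl | hb
  · obtain ⟨c, hc, hXc⟩ := hX
    simpa using h c hc hXc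
  · rw [← div_le_iff₀ hb]
    refine le_csInf hX fun c hc => ?_
    rw [div_le_iff₀ hb]
    exact h c hc.1 hc.2

end MaximalSequenceSpace

/-! ### Slicing functions by the size of their modulus -/

section Slicing

theorem one_sub_two_rpow_neg_le {x : ℝ} (hx : 0 ≤ x) : 1 - (2 : ℝ) ^ (-x) ≤ x := by
  rw [Real.rpow_def_of_pos two_pos]
  have h1 := Real.add_one_le_exp (Real.log 2 * -x)
  have h2 : Real.log 2 * x ≤ x :=
    mul_le_of_le_one_left hx (Real.log_two_lt_d9.le.trans (by norm_num))
  linarith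

/-- The convex function `2 ^ (-s)` lies below its chord on `[0, 1]`. -/
theorem two_rpow_neg_le {s : ℝ} (hs : 0 ≤ s) (hs1 : s ≤ 1) : (2 : ℝ) ^ (-s) ≤ 1 - s / 2 := by
  have h := rpow_one_add_le_one_add_mul_self (s := -(1 / 2)) (by norm_num) hs hs1
  have e : (2 : ℝ) ^ (-s) = (1 + -(1 / 2)) ^ s := by
    rw [Real.rpow_neg two_pos.le, ← Real.inv_rpow two_pos.le]
    norm_num
  rw [e]
  linarith

theorem min_sub_min_nonneg {a b : ℝ} (hba : b ≤ a) (u : ℝ) : 0 ≤ min u a - min u b :=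
  sub_nonneg.2 (min_le_min_left u hba)

theorem min_sub_min_le {a b : ℝ} (hba : b ≤ a) (u : ℝ) : min u a - min u b ≤ a - b := by
  rcases le_total u b with h | h
  · rw [min_eq_left h, min_eq_left (h.trans hba)]
    linarith
  · rw [min_eq_right h]
    linarith [min_le_right u a]

/-- A slice of `u` at height `a ^ (l + 1)` is nonzero only if `u ^ r` exceeds `2 ^ (-(l + 1))`;
weighted by `2 ^ (-(l + 1))` it is dominated by a telescoping expression in `u ^ r`. -/
theorem half_pow_mul_slice_le {r a u : ℝ} (hr : 0 < r) (ha0 : 0 < a) (ha1 : a < 1)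
    (har : a ^ r = 1 / 2) (l : ℕ) :
    (1 / 2 : ℝ) ^ (l + 1) * ((min u (a ^ l) - min u (a ^ (l + 1))) / (a ^ l - a ^ (l + 1))) ≤
      2 * (min (u ^ r) ((1 / 2) ^ (l + 1)) - min (u ^ r) ((1 / 2) ^ (l + 1 + 1))) := by
  have hlt : a ^ (l + 1) < a ^ l := pow_lt_pow_right_of_lt_one₀ ha0 ha1 (Nat.lt_succ_self l)
  have hpow : ∀ j : ℕ, (a ^ j) ^ r = (1 / 2 : ℝ) ^ j := fun j => by
    rw [← har, ← Real.rpow_natCast, ← Real.rpow_natCast, ← Real.rpow_mul ha0.le,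
      ← Real.rpow_mul ha0.le, mul_comm]
  have hh : (1 / 2 : ℝ) ^ (l + 1 + 1) ≤ (1 / 2) ^ (l + 1) :=
    pow_le_pow_of_le_one (by norm_num) (by norm_num) (Nat.le_succ _)
  rcases le_or_gt u (a ^ (l + 1)) with h | h
  · rw [min_eq_left h, min_eq_left (h.trans hlt.le), sub_self, zero_div, mul_zero]
    exact mul_nonneg two_pos.le (min_sub_min_nonneg hh _)
  · have hy : (1 / 2 : ℝ) ^ (l + 1) ≤ u ^ r := by
      rw [← hpow]
      exact Real.rpow_le_rpow (pow_pos ha0 _).le h.le hr.le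
    rw [min_eq_right hy, min_eq_right (hh.trans hy)]
    have : (min u (a ^ l) - min u (a ^ (l + 1))) / (a ^ l - a ^ (l + 1)) ≤ 1 :=
      div_le_one_of_le₀ (min_sub_min_le hlt.le u) (sub_pos.2 hlt).le
    have h3 := mul_le_mul_of_nonneg_left this (by positivity : (0 : ℝ) ≤ (1 / 2) ^ (l + 1))
    rw [pow_succ (1 / 2 : ℝ) (l + 1)]
    linarith

/-- The `L_{1/γ}`-norm of the coefficients of the slices is of order `r⁻¹ (r⁻¹ - β)^{-γ}`, where
`γ = 1 - β`. One factor `r⁻¹` is the relative thickness `1 - 2^{-1/r}` of a slice. -/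
theorem slice_coefficients_le {r β : ℝ} (hr : 1 ≤ r) (hβ : 0 ≤ β) (hβr : β < r⁻¹) {J : ℕ}
    (hJ : ((2 : ℝ) ^ (-((1 - β)⁻¹ * (r⁻¹ - β)))) ^ J ≤ r⁻¹ ^ (1 - β)⁻¹) :
    (∑ l ∈ Finset.range J, (1 / 2 : ℝ) ^ (l + 1) *
        ((((2 : ℝ) ^ (-r⁻¹)) ^ l - ((2 : ℝ) ^ (-r⁻¹)) ^ (l + 1)) * 2 ^ (l + 1)) ^ (1 - β)⁻¹ +
      (1 / 2 : ℝ) ^ J * (((2 : ℝ) ^ (-r⁻¹)) ^ J * 2 ^ J) ^ (1 - β)⁻¹) ^ (1 - β) ≤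
      4 * (r⁻¹ * (r⁻¹ - β) ^ (-(1 - β))) := by
  have hr0 : 0 < r := by linarith
  have hri : 0 < r⁻¹ := inv_pos.2 hr0
  have hri1 : r⁻¹ ≤ 1 := inv_le_one_of_one_le₀ hr
  set a : ℝ := 2 ^ (-r⁻¹) with ha
  set γ := 1 - β with hγ
  set d := r⁻¹ - β with hd
  have hd0 : 0 < d := sub_pos.2 hβr
  have hdγ : d ≤ γ := by linarith
  have hγ0 : 0 < γ := hd0.trans_le hdγ
  have hγ1 : γ ≤ 1 := by linarith
  set κ := γ⁻¹ with hκ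
  have hκ1 : 1 ≤ κ := one_le_inv_iff₀.2 ⟨hγ0, hγ1⟩
  have hκ0 : 0 < κ := by linarith
  have hκd0 : 0 < κ * d := mul_pos hκ0 hd0
  have hκd1 : κ * d ≤ 1 := by
    rw [hκ, inv_mul_le_iff₀ hγ0]
    linarith
  set θ : ℝ := 2 ^ (-(κ * d)) with hθ
  have ha0 : 0 < a := Real.rpow_pos_of_pos two_pos _
  have hθ0 : 0 < θ := Real.rpow_pos_of_pos two_pos _
  have hθ1 : θ ≤ 1 - κ * d / 2 := two_rpow_neg_le hκd0.le hκd1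
  have ha1 : 1 - a ≤ r⁻¹ := one_sub_two_rpow_neg_le hri.le
  -- `θ` is the ratio of consecutive terms of the sum.
  have hθeq : θ = 1 / 2 * (a * 2) ^ κ := by
    have e1 : a * 2 = 2 ^ (-r⁻¹ + 1) := by
      rw [Real.rpow_add two_pos, Real.rpow_one]
    have e2 : (1 / 2 : ℝ) = 2 ^ (-1 : ℝ) := by
      rw [Real.rpow_neg_one]; norm_num
    rw [e1, e2, ← Real.rpow_mul two_pos.le, ← Real.rpow_add two_pos, hθ]
    congr 1
    have : κ * γ = 1 := inv_mul_cancel₀ hγ0.ne'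
    rw [hd, show r⁻¹ - β = r⁻¹ - 1 + γ by rw [hγ]; ring]
    linarith
  have hpow : ∀ l : ℕ, (1 / 2 : ℝ) ^ l * (a ^ l * 2 ^ l) ^ κ = θ ^ l := by
    intro l
    rw [hθeq, mul_pow, ← mul_pow, ← Real.rpow_natCast ((a * 2) ^ κ),
      ← Real.rpow_mul (by positivity),
      mul_comm κ, Real.rpow_mul (by positivity), Real.rpow_natCast]
  have hterm : ∀ l : ℕ, (1 / 2 : ℝ) ^ (l + 1) * ((a ^ l - a ^ (l + 1)) * 2 ^ (l + 1)) ^ κ ≤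
      r⁻¹ ^ κ * (2 ^ κ / 2) * θ ^ l := by
    intro l
    have h1 : (a ^ l - a ^ (l + 1)) * 2 ^ (l + 1) ≤ r⁻¹ * 2 * (a ^ l * 2 ^ l) := by
      have : a ^ l - a ^ (l + 1) = a ^ l * (1 - a) := by ring
      rw [this, pow_succ]
      have := mul_le_mul_of_nonneg_left ha1 (by positivity : 0 ≤ a ^ l * (2 ^ l * 2))
      linarith
    have ha1' : a ≤ 1 := Real.rpow_le_one_of_one_le_of_nonpos one_le_two (by linarith)
    have h0 : 0 ≤ (a ^ l - a ^ (l + 1)) * 2 ^ (l + 1) := by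
      have : a ^ (l + 1) ≤ a ^ l := pow_le_pow_of_le_one ha0.le ha1' (Nat.le_succ l)
      have := sub_nonneg.2 this
      positivity
    calc (1 / 2 : ℝ) ^ (l + 1) * ((a ^ l - a ^ (l + 1)) * 2 ^ (l + 1)) ^ κ
        ≤ (1 / 2 : ℝ) ^ (l + 1) * (r⁻¹ * 2 * (a ^ l * 2 ^ l)) ^ κ := by gcongr
      _ = r⁻¹ ^ κ * (2 ^ κ / 2) * θ ^ l := by
          rw [Real.mul_rpow (by positivity) (by positivity), Real.mul_rpow hri.le two_pos.le,
            ← hpow, pow_succ]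
          ring
  have hgeom : ∑ l ∈ Finset.range J, θ ^ l ≤ 2 / (κ * d) := by
    have hlt : θ < 1 := by linarith
    calc ∑ l ∈ Finset.range J, θ ^ l ≤ ∑' l : ℕ, θ ^ l :=
          (summable_geometric_of_lt_one hθ0.le hlt).sum_le_tsum _ fun l _ => (pow_pos hθ0 l).le
      _ = (1 - θ)⁻¹ := tsum_geometric_of_lt_one hθ0.le hlt
      _ ≤ (κ * d / 2)⁻¹ := by
          apply inv_anti₀ (by positivity)
          linarith
      _ = 2 / (κ * d) := by rw [inv_div]
  have h2κ : (2 : ℝ) ≤ 2 ^ κ := by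
    simpa using Real.rpow_le_rpow_of_exponent_le one_le_two hκ1
  have h4κ : (4 : ℝ) ^ κ = 2 ^ κ * 2 ^ κ := by
    rw [← Real.mul_rpow two_pos.le two_pos.le]
    norm_num
  have htotal : ∑ l ∈ Finset.range J,
      (1 / 2 : ℝ) ^ (l + 1) * ((a ^ l - a ^ (l + 1)) * 2 ^ (l + 1)) ^ κ +
      (1 / 2 : ℝ) ^ J * (a ^ J * 2 ^ J) ^ κ ≤ r⁻¹ ^ κ * 4 ^ κ * d⁻¹ := by
    have hrk : 0 < r⁻¹ ^ κ := Real.rpow_pos_of_pos hri _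
    have hd1 : 1 ≤ d⁻¹ := one_le_inv_iff₀.2 ⟨hd0, hdγ.trans hγ1⟩
    calc _ ≤ ∑ l ∈ Finset.range J, r⁻¹ ^ κ * (2 ^ κ / 2) * θ ^ l + r⁻¹ ^ κ := by
          rw [hpow J]
          exact add_le_add (Finset.sum_le_sum fun l _ => hterm l) hJ
      _ ≤ r⁻¹ ^ κ * (2 ^ κ / 2) * (2 / (κ * d)) + r⁻¹ ^ κ := by
          rw [← Finset.mul_sum]
          gcongr
      _ = r⁻¹ ^ κ * (2 ^ κ * (κ⁻¹ * d⁻¹) + 1) := by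
          field_simp
      _ ≤ r⁻¹ ^ κ * (2 ^ κ * (1 * d⁻¹) + d⁻¹) := by
          gcongr
          exact inv_le_one_of_one_le₀ hκ1
      _ = r⁻¹ ^ κ * (2 ^ κ + 1) * d⁻¹ := by ring
      _ ≤ r⁻¹ ^ κ * 4 ^ κ * d⁻¹ := by
          gcongr
          rw [h4κ]
          nlinarith
  have hnn : 0 ≤ ∑ l ∈ Finset.range J,
      (1 / 2 : ℝ) ^ (l + 1) * ((a ^ l - a ^ (l + 1)) * 2 ^ (l + 1)) ^ κ +
      (1 / 2 : ℝ) ^ J * (a ^ J * 2 ^ J) ^ κ := by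
    have ha1' : a ≤ 1 := Real.rpow_le_one_of_one_le_of_nonpos one_le_two (by linarith)
    refine add_nonneg (Finset.sum_nonneg fun l _ => ?_) (by positivity)
    have : a ^ (l + 1) ≤ a ^ l := pow_le_pow_of_le_one ha0.le ha1' (Nat.le_succ l)
    have := sub_nonneg.2 this
    positivity
  calc _ ≤ (r⁻¹ ^ κ * 4 ^ κ * d⁻¹) ^ γ := Real.rpow_le_rpow hnn htotal hγ0.le
    _ = 4 * (r⁻¹ * d ^ (-γ)) := by
        rw [Real.mul_rpow (by positivity) (by positivity), Real.mul_rpow (by positivity)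
          (by positivity), Real.rpow_inv_rpow hri.le hγ0.ne',
          Real.rpow_inv_rpow (by norm_num) hγ0.ne', Real.inv_rpow hd0.le, Real.rpow_neg hd0.le]
        ring

variable {𝕜 : Type*} [RCLike 𝕜] {K : Type*} [TopologicalSpace K]

/-- Functions with `∑ k, |x k|^r ≤ 1` are averages, with respect to one probability weight `p` on
finitely many levels and with the same coefficients `s`, of normalized slices `g k l` of bounded
expected overlap. The level `some l` carries the part of `|x k|` between `2^{-(l+1)/r}` and
`2^{-l/r}`, and `none` carries the part below the last of these thresholds. -/
theorem exists_slicing {n : ℕ} {r β : ℝ} (hr : 1 ≤ r) (hβ : 0 ≤ β) (hβr : β < r⁻¹)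
    (x : Fin n → C(K, 𝕜)) (hx : ∀ t, ∑ k, ‖x k t‖ ^ r ≤ 1) :
    ∃ (J : ℕ) (p s : Option (Fin J) → ℝ) (g : Fin n → Option (Fin J) → C(K, 𝕜)),
      (∀ l, 0 ≤ p l) ∧ ∑ l, p l = 1 ∧ (∀ l, 0 ≤ s l) ∧ (∀ k l t, ‖g k l t‖ ≤ 1) ∧
      (∀ t, ∑ k, ∑ l, p l * ‖g k l t‖ ≤ 3) ∧
      (∑ l, p l * s l ^ (1 - β)⁻¹) ^ (1 - β) ≤ 4 * (r⁻¹ * (r⁻¹ - β) ^ (-(1 - β))) ∧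
      ∀ k, ∑ l, ((p l * s l : ℝ) : 𝕜) • g k l = x k := by
  have hr0 : 0 < r := by linarith
  have hri : 0 < r⁻¹ := inv_pos.2 hr0
  have hri1 : r⁻¹ ≤ 1 := inv_le_one_of_one_le₀ hr
  have hγ0 : 0 < 1 - β := by linarith
  -- For a large number of levels the bottom part is negligible, in the bound on the coefficients
  -- and in the overlap of all `n` functions.
  obtain ⟨J, hJ1, hJ2⟩ : ∃ J : ℕ,
      ((2 : ℝ) ^ (-((1 - β)⁻¹ * (r⁻¹ - β)))) ^ J ≤ r⁻¹ ^ (1 - β)⁻¹ ∧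
      (n : ℝ) * (1 / 2) ^ J ≤ 1 := by
    have hθ : (2 : ℝ) ^ (-((1 - β)⁻¹ * (r⁻¹ - β))) < 1 :=
      Real.rpow_lt_one_of_one_lt_of_neg one_lt_two
        (neg_lt_zero.2 (mul_pos (inv_pos.2 hγ0) (sub_pos.2 hβr)))
    have t1 := tendsto_pow_atTop_nhds_zero_of_lt_one (Real.rpow_pos_of_pos two_pos _).le hθ
    have t2 : Tendsto (fun J : ℕ => (n : ℝ) * (1 / 2) ^ J) atTop (𝓝 0) := by
      simpa using (tendsto_pow_atTop_nhds_zero_of_lt_one (r := (1 / 2 : ℝ))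
        (by norm_num) (by norm_num)).const_mul (n : ℝ)
    exact ((t1.eventually_le_const (Real.rpow_pos_of_pos hri _)).and
      (t2.eventually_le_const one_pos)).exists
  set a : ℝ := 2 ^ (-r⁻¹) with ha
  have ha0 : 0 < a := Real.rpow_pos_of_pos two_pos _
  have ha1 : a < 1 := Real.rpow_lt_one_of_one_lt_of_neg one_lt_two (neg_lt_zero.2 hri)
  have har : a ^ r = 1 / 2 := by
    rw [ha, ← Real.rpow_mul two_pos.le, neg_mul, inv_mul_cancel₀ hr0.ne', Real.rpow_neg_one]
    norm_num
  have hc : ∀ l : ℕ, 0 < a ^ l - a ^ (l + 1) := fun l =>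
    sub_pos.2 (pow_lt_pow_right_of_lt_one₀ ha0 ha1 (Nat.lt_succ_self l))
  have haJ : 0 < a ^ J := pow_pos ha0 J
  have hmax : ∀ u : ℝ, 0 < max u (a ^ J) := fun u => lt_max_of_lt_right haJ
  have hx1 : ∀ k t, ‖x k t‖ ≤ 1 := by
    intro k t
    have h1 : ‖x k t‖ ^ r ≤ 1 :=
      (Finset.single_le_sum (f := fun k => ‖x k t‖ ^ r)
        (fun i _ => Real.rpow_nonneg (norm_nonneg _) _) (Finset.mem_univ k)).trans (hx t)
    by_contra h
    exact absurd h1 (not_le.2 (Real.one_lt_rpow (not_le.1 h) hr0))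
  -- The slices have the form `mult l |x| * x`. The denominator `max u (a ^ J)` makes `mult`
  -- continuous at `0`: for `u < a ^ J` the slices above `a ^ J` vanish, and `none` carries all
  -- of `x`.
  let mult : Option (Fin J) → ℝ → ℝ := fun o u => match o with
    | none => 1 / max u (a ^ J)
    | some l => ((min u (a ^ (l : ℕ)) - min u (a ^ ((l : ℕ) + 1))) /
        (a ^ (l : ℕ) - a ^ ((l : ℕ) + 1))) / max u (a ^ J)
  have hmultc : ∀ o, Continuous (mult o) := by
    rintro (_ | l)
    · exact continuous_const.div (by fun_prop) fun u => (hmax u).ne'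
    · exact Continuous.div (by fun_prop) (by fun_prop) fun u => (hmax u).ne'
  have hslice0 : ∀ (l : ℕ) (u : ℝ),
      0 ≤ (min u (a ^ l) - min u (a ^ (l + 1))) / (a ^ l - a ^ (l + 1)) := fun l u =>
    div_nonneg (min_sub_min_nonneg (sub_nonneg.1 (hc l).le) u) (hc l).le
  have hslice1 : ∀ (l : ℕ) (u : ℝ),
      (min u (a ^ l) - min u (a ^ (l + 1))) / (a ^ l - a ^ (l + 1)) ≤ 1 := fun l u =>
    div_le_one_of_le₀ (min_sub_min_le (sub_nonneg.1 (hc l).le) u) (hc l).le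
  have hquot : ∀ u : ℝ, u / max u (a ^ J) ≤ 1 := fun u =>
    div_le_one_of_le₀ (le_max_left _ _) (hmax u).le
  let g : Fin n → Option (Fin J) → C(K, 𝕜) := fun k o =>
    ⟨fun t => ((mult o ‖x k t‖ : ℝ) : 𝕜) * x k t,
      (RCLike.continuous_ofReal.comp ((hmultc o).comp (x k).continuous.norm)).mul
        (x k).continuous⟩
  have hgnone : ∀ k t, ‖g k none t‖ ≤ 1 := by
    intro k t
    have : ‖g k none t‖ = ‖x k t‖ / max ‖x k t‖ (a ^ J) := by
      simp only [g, mult, ContinuousMap.coe_mk, norm_mul, RCLike.norm_ofReal]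
      rw [abs_of_pos (one_div_pos.2 (hmax _))]
      ring
    rw [this]
    exact hquot _
  have hgsome : ∀ k (l : Fin J) t, ‖g k (some l) t‖ ≤
      (min ‖x k t‖ (a ^ (l : ℕ)) - min ‖x k t‖ (a ^ ((l : ℕ) + 1))) /
        (a ^ (l : ℕ) - a ^ ((l : ℕ) + 1)) := by
    intro k l t
    have : ‖g k (some l) t‖ = (min ‖x k t‖ (a ^ (l : ℕ)) - min ‖x k t‖ (a ^ ((l : ℕ) + 1))) /
        (a ^ (l : ℕ) - a ^ ((l : ℕ) + 1)) * (‖x k t‖ / max ‖x k t‖ (a ^ J)) := by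
      simp only [g, mult, ContinuousMap.coe_mk, norm_mul, RCLike.norm_ofReal]
      rw [abs_of_nonneg (div_nonneg (hslice0 _ _) (hmax _).le)]
      ring
    rw [this]
    exact mul_le_of_le_one_right (hslice0 _ _) (hquot _)
  let p : Option (Fin J) → ℝ := fun o => match o with
    | none => (1 / 2) ^ J
    | some l => (1 / 2) ^ ((l : ℕ) + 1)
  let s : Option (Fin J) → ℝ := fun o => match o with
    | none => a ^ J * 2 ^ J
    | some l => (a ^ (l : ℕ) - a ^ ((l : ℕ) + 1)) * 2 ^ ((l : ℕ) + 1)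
  have hsum : ∀ φ : ℕ → ℝ, ∑ l : Fin J, φ l = ∑ l ∈ Finset.range J, φ l := fun φ =>
    Fin.sum_univ_eq_sum_range φ J
  refine ⟨J, p, s, g, ?_, ?_, ?_, ?_, ?_, ?_, ?_⟩
  · rintro (_ | l) <;> simp only [p] <;> positivity
  · rw [Fintype.sum_option]
    simp only [p]
    rw [hsum fun l => (1 / 2 : ℝ) ^ (l + 1)]
    have : ∀ l : ℕ, (1 / 2 : ℝ) ^ (l + 1) = (1 / 2) ^ l - (1 / 2) ^ (l + 1) := fun l => by
      rw [pow_succ]; ring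
    rw [Finset.sum_congr rfl fun l _ => this l, Finset.sum_range_sub']
    ring
  · rintro (_ | l)
    · simp only [s]; positivity
    · have := hc l
      simp only [s]; positivity
  · rintro k (_ | l) t
    · exact hgnone k t
    · exact (hgsome k l t).trans (hslice1 _ _)
  · intro t
    have h : ∀ k, ∑ l, p l * ‖g k l t‖ ≤ (1 / 2) ^ J + 2 * ‖x k t‖ ^ r := by
      intro k
      rw [Fintype.sum_option]
      refine add_le_add ?_ ?_
      · exact mul_le_of_le_one_right (by positivity) (hgnone k t)
      · have h1 : ∀ l : Fin J, p (some l) * ‖g k (some l) t‖ ≤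
            2 * (min (‖x k t‖ ^ r) ((1 / 2) ^ ((l : ℕ) + 1)) -
              min (‖x k t‖ ^ r) ((1 / 2) ^ ((l : ℕ) + 1 + 1))) := fun l =>
          (mul_le_mul_of_nonneg_left (hgsome k l t) (by positivity)).trans
            (half_pow_mul_slice_le hr0 ha0 ha1 har l)
        refine (Finset.sum_le_sum fun l _ => h1 l).trans ?_
        rw [← Finset.mul_sum, hsum fun l => min (‖x k t‖ ^ r) ((1 / 2) ^ (l + 1)) -
              min (‖x k t‖ ^ r) ((1 / 2) ^ (l + 1 + 1)),
          Finset.sum_range_sub' (fun l => min (‖x k t‖ ^ r) ((1 / 2 : ℝ) ^ (l + 1)))]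
        have h2 : 0 ≤ min (‖x k t‖ ^ r) ((1 / 2 : ℝ) ^ (J + 1)) :=
          le_min (Real.rpow_nonneg (norm_nonneg _) _) (by positivity)
        have h3 := min_le_left (‖x k t‖ ^ r) ((1 / 2 : ℝ) ^ (0 + 1))
        linarith
    refine (Finset.sum_le_sum fun k _ => h k).trans ?_
    rw [Finset.sum_add_distrib, ← Finset.mul_sum]
    simp only [Finset.sum_const, Finset.card_univ, Fintype.card_fin, nsmul_eq_mul]
    linarith [hx t]
  · rw [Fintype.sum_option]
    simp only [p, s]
    rw [hsum fun l => (1 / 2 : ℝ) ^ (l + 1) *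
      ((a ^ l - a ^ (l + 1)) * 2 ^ (l + 1)) ^ (1 - β)⁻¹, add_comm]
    exact slice_coefficients_le hr hβ hβr hJ1
  · intro k
    ext t
    have hterm : ∀ o, p o * s o * mult o ‖x k t‖ = match o with
        | none => a ^ J / max ‖x k t‖ (a ^ J)
        | some l => (min ‖x k t‖ (a ^ (l : ℕ)) - min ‖x k t‖ (a ^ ((l : ℕ) + 1))) /
            max ‖x k t‖ (a ^ J) := by
      have h2 : ∀ j : ℕ, (1 / 2 : ℝ) ^ j * 2 ^ j = 1 := fun j => by
        rw [← mul_pow]; norm_num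
      rintro (_ | l)
      · simp only [p, s, mult]
        linear_combination (a ^ J / max ‖x k t‖ (a ^ J)) * h2 J
      · simp only [p, s, mult]
        have := (hc l).ne'
        have h4 := h2 (l + 1)
        have h5 := mul_div_cancel₀ (min ‖x k t‖ (a ^ (l : ℕ)) - min ‖x k t‖ (a ^ ((l : ℕ) + 1))) this
        linear_combination ((min ‖x k t‖ (a ^ (l : ℕ)) - min ‖x k t‖ (a ^ ((l : ℕ) + 1))) /
          max ‖x k t‖ (a ^ J)) * h4 +
          ((1 / 2) ^ ((l : ℕ) + 1) * 2 ^ ((l : ℕ) + 1) / max ‖x k t‖ (a ^ J)) * h5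
    have hone : ∑ o, p o * s o * mult o ‖x k t‖ = 1 := by
      rw [Finset.sum_congr rfl fun o _ => hterm o, Fintype.sum_option]
      simp only
      rw [hsum fun l => (min ‖x k t‖ (a ^ l) - min ‖x k t‖ (a ^ (l + 1))) / max ‖x k t‖ (a ^ J),
        ← Finset.sum_div, Finset.sum_range_sub' (fun l => min ‖x k t‖ (a ^ l)), pow_zero,
        min_eq_left (hx1 k t), ← add_div, div_eq_one_iff_eq (hmax _).ne']
      linarith [min_add_max ‖x k t‖ (a ^ J)]
    simp only [ContinuousMap.coe_sum, ContinuousMap.coe_smul, Finset.sum_apply, Pi.smul_apply,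
      g, ContinuousMap.coe_mk, smul_eq_mul]
    calc ∑ o, ((p o * s o : ℝ) : 𝕜) * (((mult o ‖x k t‖ : ℝ) : 𝕜) * x k t)
        = ((∑ o, p o * s o * mult o ‖x k t‖ : ℝ) : 𝕜) * x k t := by
          push_cast
          rw [Finset.sum_mul]
          exact Finset.sum_congr rfl fun o _ => by ring
      _ = x k t := by rw [hone, RCLike.ofReal_one, one_mul]

end Slicing

/-! ### Weak and Rademacher norms -/

section WeakNorms

variable {𝕜 : Type*} [RCLike 𝕜] {E F : Type*} [NormedAddCommGroup E] [NormedSpace 𝕜 E]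
  [NormedAddCommGroup F] [NormedSpace 𝕜 F] {n : ℕ}

theorem weakLpNorm_le_one_iff {r : ℝ≥0∞} {x : Fin n → E} :
    weakLpNorm 𝕜 r x ≤ 1 ↔
      ∀ a : StrongDual 𝕜 E, ‖a‖ ≤ 1 → finLpNorm r (fun k => a (x k)) ≤ 1 := by
  simp only [weakLpNorm, iSup_le_iff, ENNReal.ofReal_le_one]

theorem ofReal_imageNorm_le_summingNorm (X : MaximalSequenceSpace 𝕜) {r : ℝ≥0∞} (T : E →L[𝕜] F)
    {x : Fin n → E} (hx : weakLpNorm 𝕜 r x ≤ 1) :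
    ENNReal.ofReal (imageNorm X T x) ≤ summingNorm X r n T :=
  le_iSup₂_of_le (f := fun (x : Fin n → E) (_ : weakLpNorm 𝕜 r x ≤ 1) =>
    ENNReal.ofReal (imageNorm X T x)) x hx le_rfl

theorem imageNorm_nonneg (X : MaximalSequenceSpace 𝕜) (T : E →L[𝕜] F) (x : Fin n → E) :
    0 ≤ imageNorm X T x :=
  X.norm_nonneg (X.finSeq_mem _)

theorem rademacherNorm_le_one_of_forall_norm_le {x : Fin n → E}
    (h : ∀ ε : Fin n → ℤˣ, ‖∑ k, ((ε k : ℤˣ) : ℤ) • x k‖ ≤ 1) : rademacherNorm x ≤ 1 := by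
  unfold rademacherNorm
  rw [Real.sqrt_le_one, inv_mul_le_iff₀ (by positivity), mul_one]
  calc ∑ ε : Fin n → ℤˣ, ‖∑ k, ((ε k : ℤˣ) : ℤ) • x k‖ ^ 2 ≤ ∑ _ε : Fin n → ℤˣ, (1 : ℝ) :=
        Finset.sum_le_sum fun ε _ => pow_le_one₀ (norm_nonneg _) (h ε)
    _ = 2 ^ n := by simp

theorem rademacherNorm_le_one_of_weakLpNorm_one {x : Fin n → E} (hx : weakLpNorm 𝕜 1 x ≤ 1) :
    rademacherNorm x ≤ 1 := by
  refine rademacherNorm_le_one_of_forall_norm_le fun ε => ?_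
  refine NormedSpace.norm_le_dual_bound 𝕜 _ zero_le_one fun a => ?_
  rw [one_mul]
  rcases eq_or_ne a 0 with rfl | ha
  · simp
  have ha' : 0 < ‖a‖ := norm_pos_iff.2 ha
  set b : StrongDual 𝕜 E := ((‖a‖⁻¹ : ℝ) : 𝕜) • a with hb
  have hb1 : ‖b‖ ≤ 1 := by
    rw [hb, norm_smul, RCLike.norm_ofReal, abs_of_pos (inv_pos.2 ha'), inv_mul_cancel₀ ha'.ne']
  have h := weakLpNorm_le_one_iff.1 hx b hb1
  rw [finLpNorm_one] at h
  have hab : ∀ z, ‖a z‖ = ‖a‖ * ‖b z‖ := fun z => by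
    rw [hb, smul_apply, norm_smul, RCLike.norm_ofReal,
      abs_of_pos (inv_pos.2 ha'), mul_inv_cancel_left₀ ha'.ne']
  rw [hab]
  refine mul_le_of_le_one_right ha'.le (le_trans ?_ h)
  rw [map_sum]
  refine (norm_sum_le _ _).trans (Finset.sum_le_sum fun k _ => ?_)
  rw [map_zsmul]
  rcases Int.units_eq_one_or (ε k) with h | h <;> simp [h]

/-- Orthogonality of independent random signs. -/
theorem sum_norm_sum_sign_smul_sq (v : Fin n → 𝕜) :
    ∑ ε : Fin n → ℤˣ, ‖∑ k, ((ε k : ℤˣ) : ℤ) • v k‖ ^ 2 = 2 ^ n * ∑ k, ‖v k‖ ^ 2 := by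
  induction n with
  | zero => simp
  | succ n ih =>
    have hpar : ∀ z w : 𝕜, ‖z + w‖ ^ 2 + ‖-z + w‖ ^ 2 = 2 * (‖z‖ ^ 2 + ‖w‖ ^ 2) := by
      intro z w
      have h := parallelogram_law_with_norm ℝ w z
      rw [add_comm z w, neg_add_eq_sub]
      linarith
    have huniv : (Finset.univ : Finset ℤˣ) = {1, -1} := rfl
    rw [← (Fin.consEquiv fun _ : Fin (n + 1) => ℤˣ).sum_comp, Fintype.sum_prod_type, huniv,
      Finset.sum_pair (by decide), ← Finset.sum_add_distrib]
    simp only [Fin.consEquiv_apply, Fin.sum_univ_succ, Fin.cons_zero, Fin.cons_succ,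
      Units.val_one, Units.val_neg, one_smul, neg_smul, hpar]
    rw [← Finset.mul_sum, Finset.sum_add_distrib, ih (fun k => v k.succ)]
    simp only [Finset.sum_const, Finset.card_univ, Fintype.card_pi, Fintype.card_units_int,
      Finset.prod_const, Fintype.card_fin, nsmul_eq_mul]
    push_cast
    ring

theorem weakLpNorm_two_le_one_of_rademacherNorm {x : Fin n → E} (hx : rademacherNorm x ≤ 1) :
    weakLpNorm 𝕜 2 x ≤ 1 := by
  refine weakLpNorm_le_one_iff.2 fun a ha => ?_
  unfold rademacherNorm at hx
  rw [Real.sqrt_le_one, inv_mul_le_iff₀ (by positivity), mul_one] at hx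
  have h1 : ∑ ε : Fin n → ℤˣ, ‖∑ k, ((ε k : ℤˣ) : ℤ) • a (x k)‖ ^ 2 ≤ 2 ^ n := by
    refine (Finset.sum_le_sum fun ε _ => ?_).trans hx
    have e : ∑ k, ((ε k : ℤˣ) : ℤ) • a (x k) = a (∑ k, ((ε k : ℤˣ) : ℤ) • x k) := by
      simp only [map_sum, map_zsmul]
    rw [e]
    exact pow_le_pow_left₀ (norm_nonneg _) ((a.le_of_opNorm_le ha _).trans_eq (one_mul _)) 2
  rw [sum_norm_sum_sign_smul_sq] at h1
  have h2 : ∑ k, ‖a (x k)‖ ^ 2 ≤ 1 := (mul_le_iff_le_one_right (by positivity)).1 h1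
  rw [finLpNorm_eq_sum (by simp)]
  simp only [ENNReal.toReal_ofNat, Real.rpow_ofNat]
  exact Real.rpow_le_one (Finset.sum_nonneg fun _ _ => by positivity) h2 (by norm_num)

/-- All signed sums of a family with weak `ℓ_1`-norm at most `1` lie in the unit ball. -/
theorem summingNorm_one_le_rademacherCotypeNorm (X : MaximalSequenceSpace 𝕜) (n : ℕ)
    (T : E →L[𝕜] F) : summingNorm X 1 n T ≤ rademacherCotypeNorm X n T :=
  iSup₂_le fun x hx => le_iSup₂_of_le (f := fun (x : Fin n → E) (_ : rademacherNorm x ≤ 1) =>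
    ENNReal.ofReal (imageNorm X T x)) x (rademacherNorm_le_one_of_weakLpNorm_one hx) le_rfl

theorem rademacherCotypeNorm_le_summingNorm_two (X : MaximalSequenceSpace 𝕜) (n : ℕ)
    (T : E →L[𝕜] F) : rademacherCotypeNorm X n T ≤ summingNorm X 2 n T :=
  iSup₂_le fun _ hx =>
    ofReal_imageNorm_le_summingNorm X T (weakLpNorm_two_le_one_of_rademacherNorm hx)

end WeakNorms

section ContinuousFunctions

variable {𝕜 : Type*} [RCLike 𝕜] {K : Type*} [TopologicalSpace K] [CompactSpace K]
  {F : Type*} [NormedAddCommGroup F] [NormedSpace 𝕜 F] {n : ℕ}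

theorem sum_norm_rpow_le_one_of_weakLpNorm {r : ℝ≥0∞} (hr : 0 < r.toReal) {x : Fin n → C(K, 𝕜)}
    (hx : weakLpNorm 𝕜 r x ≤ 1) (t : K) : ∑ k, ‖x k t‖ ^ r.toReal ≤ 1 := by
  have hδ : ‖(ContinuousMap.evalCLM 𝕜 t : C(K, 𝕜) →L[𝕜] 𝕜)‖ ≤ 1 :=
    ContinuousLinearMap.opNorm_le_bound _ zero_le_one fun f => by
      rw [one_mul]
      exact f.norm_coe_le_norm t
  have h := weakLpNorm_le_one_iff.1 hx _ hδ
  rw [finLpNorm_eq_sum hr] at h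
  have h0 : 0 ≤ ∑ k, ‖x k t‖ ^ r.toReal :=
    Finset.sum_nonneg fun k _ => Real.rpow_nonneg (norm_nonneg _) _
  by_contra hlt
  exact absurd h (not_le.2 (Real.one_lt_rpow (not_le.1 hlt) (one_div_pos.2 hr)))

theorem exists_norm_le_one_mul_eq_norm (z : 𝕜) : ∃ u : 𝕜, ‖u‖ ≤ 1 ∧ u * z = (‖z‖ : 𝕜) := by
  rcases eq_or_ne z 0 with rfl | hz
  · exact ⟨0, by simp, by simp⟩
  · have hz' : (‖z‖ : 𝕜) ≠ 0 := RCLike.ofReal_ne_zero.2 (norm_ne_zero_iff.2 hz)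
    refine ⟨‖z‖ / z, ?_, div_mul_cancel₀ _ hz⟩
    rw [norm_div, RCLike.norm_ofReal, abs_norm, div_self (norm_ne_zero_iff.2 hz)]

theorem weakLpNorm_one_le_one_of_sum_norm_le {y : Fin n → C(K, 𝕜)}
    (hy : ∀ t, ∑ k, ‖y k t‖ ≤ 1) : weakLpNorm 𝕜 1 y ≤ 1 := by
  refine weakLpNorm_le_one_iff.2 fun a ha => ?_
  rw [finLpNorm_one]
  choose u hu1 hu using fun k => exists_norm_le_one_mul_eq_norm (a (y k))
  have e : ((∑ k, ‖a (y k)‖ : ℝ) : 𝕜) = a (∑ k, u k • y k) := by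
    simp only [map_sum, map_smul, smul_eq_mul, hu]
  have h1 : ‖∑ k, u k • y k‖ ≤ 1 := by
    refine (ContinuousMap.norm_le _ zero_le_one).2 fun t => ?_
    simp only [ContinuousMap.coe_sum, ContinuousMap.coe_smul, Finset.sum_apply, Pi.smul_apply]
    refine (norm_sum_le _ _).trans ((Finset.sum_le_sum fun k _ => ?_).trans (hy t))
    rw [norm_smul]
    exact mul_le_of_le_one_left (norm_nonneg _) (hu1 k)
  have h2 := (a.le_of_opNorm_le ha (∑ k, u k • y k)).trans (mul_le_one₀ le_rfl (norm_nonneg _) h1)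
  rw [← e, RCLike.norm_ofReal] at h2
  exact (le_abs_self _).trans h2

/-! ### Comparison of summing norms on `C(K)` -/

/-- The image norm of a weakly `r`-summable family is dominated by that of one weakly summable
family of the same length. -/
theorem exists_imageNorm_le {q r : ℝ≥0∞} (hr : 1 ≤ r) (hrq : r < q) (X : MaximalSequenceSpace 𝕜)
    (hX : X.IsConvex q) (T : C(K, 𝕜) →L[𝕜] F) {x : Fin n → C(K, 𝕜)}
    (hx : weakLpNorm 𝕜 r x ≤ 1) :
    ∃ y : Fin n → C(K, 𝕜), weakLpNorm 𝕜 1 y ≤ 1 ∧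
      imageNorm X T x ≤ 20 * X.convexityConst q * maureyFactor r q * imageNorm X T y := by
  classical
  have hq : 1 < q := hr.trans_lt hrq
  have hrtop : r ≠ ∞ := (hrq.trans_le le_top).ne
  have hr1 : 1 ≤ r.toReal := by
    rw [← ENNReal.toReal_one]
    exact ENNReal.toReal_mono hrtop hr
  have hr0 : 0 < r.toReal := by linarith
  set β := (q⁻¹).toReal with hβdef
  have hβ : 0 ≤ β := ENNReal.toReal_nonneg
  have hβr : β < r.toReal⁻¹ := by
    rw [← ENNReal.toReal_inv]
    exact ENNReal.toReal_strict_mono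
      (ENNReal.inv_ne_top.2 (zero_lt_one.trans_le hr).ne') (ENNReal.inv_lt_inv.2 hrq)
  obtain ⟨J, p, s, g, hp, hp1, hs, hg, hgA, hS, hgx⟩ :=
    exists_slicing hr1 hβ hβr x (sum_norm_rpow_le_one_of_weakLpNorm hr0 hx)
  obtain ⟨y, hy1, hy⟩ := exists_disjointification hp hp1 hg (by norm_num) hgA
  have hfac : r.toReal⁻¹ * (r.toReal⁻¹ - β) ^ (-(1 - β)) = maureyFactor r q := by
    rw [maureyFactor, ENNReal.toReal_inv r]
  rw [hfac] at hS
  have hfac0 : 0 ≤ maureyFactor r q := by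
    rw [← hfac]
    exact mul_nonneg (inv_nonneg.2 hr0.le) (Real.rpow_nonneg (sub_nonneg.2 hβr.le) _)
  -- One of the finitely many families `y ω` has the largest image norm `B`.
  obtain ⟨ω₀, hω₀⟩ := Finite.exists_max fun ω => imageNorm X T (y ω)
  refine ⟨y ω₀, weakLpNorm_one_le_one_of_sum_norm_le (hy1 ω₀), ?_⟩
  set B := imageNorm X T (y ω₀) with hB
  have hB0 : 0 ≤ B := imageNorm_nonneg X T _
  have key : imageNorm X T x ≤ X.convexityConst q * (20 * maureyFactor r q * B) := by
    refine hX.le_mul_convexityConst (by positivity) fun c hc hXc => ?_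
    -- Convexity is stated for families indexed by `Fin N`, so the choices are enumerated.
    let e := (Fintype.equivFin (Fin n → Option (Fin J))).symm
    have hP : ∀ ω : Fin n → Option (Fin J), 0 ≤ ∏ i, p (ω i) := fun ω =>
      Finset.prod_nonneg fun i _ => hp _
    have hmain := hXc.norm_finSeq_le hc hq (P := fun j => ∏ i, p (e j i)) (fun j => hP _)
      ((e.sum_comp fun ω => ∏ i, p (ω i)).trans (sum_prod_weights_eq_one hp1))
      (y := fun j k => ‖T (y (e j) k)‖) hB0 (fun j => hω₀ (e j))
      (C := 20 * maureyFactor r q) (by positivity) (v := fun k => ‖T (x k)‖) ?_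
    · exact hmain.trans_eq (by ring)
    · intro k
      rw [abs_norm]
      have h1 : T (x k) = ((2 + 3 : ℝ) : 𝕜) •
          ∑ ω : Fin n → Option (Fin J), (((∏ i, p (ω i)) * s (ω k) : ℝ) : 𝕜) • T (y ω k) := by
        rw [← hgx k, hy s k, map_smul, map_sum]
        simp only [map_smul]
      have h2 : ‖T (x k)‖ ≤ 5 * ∑ ω : Fin n → Option (Fin J),
          (∏ i, p (ω i)) * s (ω k) * ‖T (y ω k)‖ := by
        rw [h1, norm_smul, RCLike.norm_ofReal, abs_of_pos (by norm_num)]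
        refine mul_le_mul (by norm_num) ((norm_sum_le _ _).trans_eq ?_) (norm_nonneg _)
          (by norm_num)
        refine Finset.sum_congr rfl fun ω _ => ?_
        rw [norm_smul, RCLike.norm_ofReal, abs_of_nonneg (mul_nonneg (hP ω) (hs _))]
      have h3 := sum_weight_mul_le_finLpNorm hq (P := fun j => ∏ i, p (e j i))
        (u := fun j => s (e j k)) (z := fun j => ‖T (y (e j) k)‖) (fun j => hP _)
        (fun j => hs _)
      rw [e.sum_comp fun ω => (∏ i, p (ω i)) * s (ω k) * ‖T (y ω k)‖,
        e.sum_comp fun ω => (∏ i, p (ω i)) * s (ω k) ^ (1 - β)⁻¹,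
        sum_prod_weights_mul_marginal hp1 k fun l => s l ^ (1 - β)⁻¹] at h3
      have h4 := h3.trans (mul_le_mul_of_nonneg_right hS (finLpNorm_nonneg _ _))
      linarith
  exact key.trans_eq (by ring)

theorem summingNorm_le_mul_summingNorm_one {q r : ℝ≥0∞} (hr : 1 ≤ r) (hrq : r < q)
    (X : MaximalSequenceSpace 𝕜) (hX : X.IsConvex q) (T : C(K, 𝕜) →L[𝕜] F) (n : ℕ) :
    summingNorm X r n T ≤
      ENNReal.ofReal (20 * X.convexityConst q * maureyFactor r q) * summingNorm X 1 n T := by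
  refine iSup₂_le fun x hx => ?_
  obtain ⟨y, hy, hxy⟩ := exists_imageNorm_le hr hrq X hX T hx
  refine (ENNReal.ofReal_le_ofReal hxy).trans ?_
  rw [ENNReal.ofReal_mul' (imageNorm_nonneg X T y)]
  gcongr
  exact ofReal_imageNorm_le_summingNorm X T hy

end ContinuousFunctions

theorem mainTheorem2 :
    ∃ c₀ : ℝ, 0 < c₀ ∧
      ∀ (𝕜 : Type*) [RCLike 𝕜] (q : ℝ≥0∞) (X : MaximalSequenceSpace 𝕜),
        X.IsSymmetric → X.IsConvex q →
        ∀ (K : Type*) [TopologicalSpace K] [CompactSpace K] [T2Space K]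
          (F : Type*) [NormedAddCommGroup F] [NormedSpace 𝕜 F] [CompleteSpace F]
          (T : C(K, 𝕜) →L[𝕜] F),
          (∀ r : ℝ≥0∞, 1 ≤ r → r < q → ∀ n : ℕ,
            summingNorm X r n T ≤
              ENNReal.ofReal (c₀ * X.convexityConst q * maureyFactor r q) *
                summingNorm X 1 n T) ∧
          (2 < q →
            (∀ n : ℕ,
              summingNorm X 1 n T ≤ rademacherCotypeNorm X n T ∧
              rademacherCotypeNorm X n T ≤ ENNReal.ofReal (Real.sqrt 2) * summingNorm X 2 n T ∧
              ENNReal.ofReal (Real.sqrt 2) * summingNorm X 2 n T ≤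
                ENNReal.ofReal (c₀ * X.convexityConst q *
                  ((1 / 2 : ℝ) - (q⁻¹).toReal) ^ (-(1 - (q⁻¹).toReal))) *
                  summingNorm X 1 n T) ∧
            List.TFAE [IsSumming X 2 T, IsOfRademacherCotype X T, IsSumming X 1 T]) := by
  refine ⟨20, by norm_num, fun 𝕜 _ q X _ hX K _ _ _ F _ _ _ T => ?_⟩
  have part1 := fun (r : ℝ≥0∞) (hr : 1 ≤ r) (hrq : r < q) (n : ℕ) =>
    summingNorm_le_mul_summingNorm_one hr hrq X hX T n
  refine ⟨part1, fun h2q => ?_⟩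
  have hM : 0 ≤ X.convexityConst q := Real.sInf_nonneg fun c hc => hc.1.le
  have hsqrt : Real.sqrt 2 ≤ 2 := by
    rw [Real.sqrt_le_left two_pos.le]
    norm_num
  have hrc : ∀ n, rademacherCotypeNorm X n T ≤ summingNorm X 2 n T := fun n =>
    rademacherCotypeNorm_le_summingNorm_two X n T
  have hq2 : (q⁻¹).toReal < 1 / 2 := by
    have := ENNReal.toReal_strict_mono (ENNReal.inv_ne_top.2 two_ne_zero)
      (ENNReal.inv_lt_inv.2 h2q)
    rwa [ENNReal.toReal_inv 2, ENNReal.toReal_ofNat, ← one_div (2 : ℝ)] at this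
  have hfac0 : 0 ≤ ((1 / 2 : ℝ) - (q⁻¹).toReal) ^ (-(1 - (q⁻¹).toReal)) :=
    Real.rpow_nonneg (by linarith) _
  have hfac : maureyFactor 2 q =
      1 / 2 * ((1 / 2 : ℝ) - (q⁻¹).toReal) ^ (-(1 - (q⁻¹).toReal)) := by
    rw [maureyFactor, ENNReal.toReal_inv 2, ENNReal.toReal_ofNat, ← one_div (2 : ℝ)]
  refine ⟨fun n => ⟨summingNorm_one_le_rademacherCotypeNorm X n T, ?_, ?_⟩, ?_⟩
  · refine (hrc n).trans (le_mul_of_one_le_left zero_le ?_)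
    rw [ENNReal.one_le_ofReal]
    exact Real.one_le_sqrt.2 one_le_two
  · refine (mul_le_mul_right (part1 2 one_le_two h2q n) _).trans ?_
    rw [← mul_assoc, ← ENNReal.ofReal_mul (Real.sqrt_nonneg 2), hfac]
    refine mul_le_mul_left (ENNReal.ofReal_le_ofReal ?_) _
    have := mul_le_mul_of_nonneg_right hsqrt (mul_nonneg hM hfac0)
    linarith
  · tfae_have 1 → 2 := fun h => (iSup_mono hrc).trans_lt h
    tfae_have 2 → 3 := fun h =>
      (iSup_mono fun n => summingNorm_one_le_rademacherCotypeNorm X n T).trans_lt h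
    tfae_have 3 → 1 := fun h => by
      refine (iSup_mono (part1 2 one_le_two h2q)).trans_lt ?_
      rw [← ENNReal.mul_iSup]
      exact ENNReal.mul_lt_top ENNReal.ofReal_lt_top h
    tfae_finish
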